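/- **Theorem 3 (high-noise limit).** Consider a chain of nodes $0,1,\dots,m$ ($m\ge1$). Node $0$ is given a uniformly distributed bit $\Theta\in\{0,1\}$. At each time $i\in\{1,\dots,n\}$, each node $j\in\{0,\dots,m-1\}$ sends one bit $X_{i,j}$ to node $j+1$ through a binary symmetric channel with crossover probability $p\in(0,\frac12)$, with output $Y_{i,j}$; the channels are memoryless and independent across nodes. A protocol of block length $n$ specifies each $X_{i,0}$ as a function of $\Theta$, each $X_{i,j}$ with $1\le j\le m-1$ as a function of $Y_{1,j-1},\dots,Y_{i-1,j-1}$, and an estimate $\hat\Theta$ as a function of $Y_{1,m-1},\dots,Y_{n,m-1}$. For $\epsilon\in(0,\frac12)$ let $n^*_\epsilon(m,p)$ be the minimum block length $n$ for which some protocol has $\mathbb P(\hat\Theta\ne\Theta)\le\epsilon$, and define the (lower and upper) information velocities $$\underline v_\epsilon(p)=\liminf_{m\to\infty}\frac{m}{n^*_\epsilon(m,p)},\qquad \overline v_\epsilon(p)=\limsup_{m\to\infty}\frac{m}{n^*_\epsilon(m,p)} ;$$ the information velocity $v(p)=\lim_{m\to\infty} m/n^*_{1/3}(m,p)$, when the limit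 exists, is their common value for $\epsilon=\frac13$. Let also $\underline v_0(p)$ and $\overline v_0(p)$ be the suprema of $\liminf_{m\to\infty} m/n_m$ and of $\limsup_{m\to\infty} m/n_m$, respectively, over all sequences of block lengths $(n_m)$ for which there are protocols over $m$ hops with block length $n_m$ and $\mathbb P(\hat\Theta\ne\Theta)\to0$ as $m\to\infty$. Then, as $\delta\to0^+$, the information velocity is of order $\delta^2$: for every fixed $\epsilon\in(0,\frac12)$ (in particular $\epsilon=\frac13$), $$\underline v_\epsilon\Big(\frac{1-\delta}2\Big)=\Theta(\delta^2)\quad\text{and}\quad \overline v_\epsilon\Big(\frac{1-\delta}2\Big)=\Theta(\delta^2),$$ and likewise $$\underline v_0\Big(\frac{1-\delta}2\Big)=\Theta(\delta^2)\quad\text{and}\quad \overline v_0\Big(\frac{1-\delta}2\Big)=\Theta(\delta^2).$$ -/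

import Mathlib

open Filter Topology Asymptotics

noncomputable section

namespace BitRelay

/-- A (deterministic) protocol relaying one bit through `r` relays, i.e. over `m = r + 1` hops, with
block length `n`. The nodes are `0, …, r + 1`; node `0` is the encoder, node `r + 1` the decoder.
Times are indexed by `Fin n`, starting at `0`.
* `encode θ i`: the bit that node `0` sends at time `i` when the message is `θ`;
* `relay k i h`: the bit that relay node `k + 1` sends at time `i`, where `h` is the sequence of the
  `i` bits that it received strictly before time `i`;
* `decode h`: the estimate that node `r + 1` forms from the `n` bits it received. -/
structure Protocol (r n : ℕ) where
  encode : Bool → Fin n → Bool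
  relay : Fin r → (i : Fin n) → (Fin i → Bool) → Bool
  decode : (Fin n → Bool) → Bool

/-- Transition probability of the binary symmetric channel with crossover probability `p`
from the input `x` to the output `y`. -/
def bsc (p : ℝ) (x y : Bool) : ℝ := if y = x then 1 - p else p

namespace Protocol

variable {r n : ℕ}

/-- The channel input `X i j`, sent by node `j` to node `j + 1` at time `i`, when the message is `θ`
and the channel outputs are `y`; here `y i j` is received by node `j + 1` at time `i`. -/
def sent (P : Protocol r n) (θ : Bool) (y : Fin n → Fin (r + 1) → Bool)
    (i : Fin n) (j : Fin (r + 1)) : Bool :=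
  Fin.cases (P.encode θ i)
    (fun k => P.relay k i (fun t => y (Fin.castLE i.isLt.le t) k.castSucc)) j

/-- Conditional probability of the table `y` of all channel outputs, given the message `θ`:
the channels are memoryless and independent across nodes. -/
def outputProb (P : Protocol r n) (p : ℝ) (θ : Bool) (y : Fin n → Fin (r + 1) → Bool) : ℝ :=
  ∏ i, ∏ j, bsc p (P.sent θ y i j) (y i j)

/-- The error probability of the protocol for a uniformly distributed message bit. -/
def errorProb (P : Protocol r n) (p : ℝ) : ℝ :=
  ∑ θ : Bool, (1 / 2 : ℝ) * ∑ y : Fin n → Fin (r + 1) → Bool,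
    if P.decode (fun i => y i (Fin.last r)) ≠ θ then P.outputProb p θ y else 0

end Protocol

/-- The minimum block length with which one bit can be sent over `r + 1` hops with error
probability at most `ε`. -/
def minBlockLength (ε p : ℝ) (r : ℕ) : ℕ :=
  sInf {n : ℕ | ∃ P : Protocol r n, P.errorProb p ≤ ε}

/-- Lower information velocity: `liminf m / n*(m, p)` as the number `m = r + 1` of hops grows, where
`n*(m, p)` refers to error probability at most `ε`. -/
def lowerVelocity (ε p : ℝ) : ℝ :=
  liminf (fun r : ℕ => ((r + 1 : ℕ) : ℝ) / (minBlockLength ε p r : ℝ)) atTop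

/-- Upper information velocity: `limsup m / n*(m, p)`. -/
def upperVelocity (ε p : ℝ) : ℝ :=
  limsup (fun r : ℕ => ((r + 1 : ℕ) : ℝ) / (minBlockLength ε p r : ℝ)) atTop

/-- The block lengths `n r` (for `m = r + 1` hops) allow protocols with vanishing error
probability. -/
def HasVanishingError (p : ℝ) (n : ℕ → ℕ) : Prop :=
  ∃ P : (r : ℕ) → Protocol r (n r), Tendsto (fun r => (P r).errorProb p) atTop (𝓝 0)

/-- Lower information velocity under vanishing error probability: the supremum of
`liminf m / n_m` over all block length sequences that allow vanishing error probability. -/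
def lowerVanishingVelocity (p : ℝ) : ℝ :=
  sSup {v : ℝ | ∃ n : ℕ → ℕ, HasVanishingError p n ∧
    v = liminf (fun r : ℕ => ((r + 1 : ℕ) : ℝ) / (n r : ℝ)) atTop}

/-- Upper information velocity under vanishing error probability: as `lowerVanishingVelocity`,
with `limsup`. -/
def upperVanishingVelocity (p : ℝ) : ℝ :=
  sSup {v : ℝ | ∃ n : ℕ → ℕ, HasVanishingError p n ∧
    v = limsup (fun r : ℕ => ((r + 1 : ℕ) : ℝ) / (n r : ℝ)) atTop}

end BitRelay

end

/-!
Write `η = (1 - 2 * p) ^ 2`. Let `I i j` be the chi-squared information about the message in the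
first `i` outputs received by node `j`. Since the bit sent by node `j` at time `i + 1` depends on
these outputs only, the contraction of this information by a binary symmetric channel gives
`I (i + 1) (j + 1) ≤ (1 - η) * I i (j + 1) + η * I i j`. Hence `I i j ≤ 4 * 2⁻ʲ * (1 + η) ^ i`, so
that a message bit can only be recovered if the number of hops is `O(η * n)`.

Conversely, a bit can be sent over one hop by repeating it `O(1 / η)` times. Given a scheme whose
error probability `ε` is small and in which each node is active for a time `τ`, repeat it three
times with a majority vote, and concatenate four copies of the result. This multiplies the number
of hops by `4`, the active times by `3` and the error probability by at most `1 / 4`. The delay is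
multiplied by `4` up to a term `9 * τ`. As `3 < 4`, the time needed per hop stays `O(1 / η)` while
the error probability tends to `0` with the number of hops.
-/

namespace BitRelay

open Matrix

section Stochastic

variable {ι κ α β γ : Type*}

/-- `W` is the matrix of transition probabilities of a channel with inputs in `α` and outputs in
`β`; the rectangular version of `Matrix.rowStochastic`. -/
def IsStochastic [Fintype β] (W : Matrix α β ℝ) : Prop :=
  ∀ x, W x ∈ stdSimplex ℝ β

namespace IsStochastic

lemma nonneg [Fintype β] {W : Matrix α β ℝ} (hW : IsStochastic W) (x : α) (y : β) : 0 ≤ W x y :=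
  (hW x).1 y

lemma sum_eq_one [Fintype β] {W : Matrix α β ℝ} (hW : IsStochastic W) (x : α) :
    ∑ y, W x y = 1 :=
  (hW x).2

lemma one [Fintype α] [DecidableEq α] : IsStochastic (1 : Matrix α α ℝ) := fun x => by
  simpa only [← Matrix.one_apply] using ite_eq_mem_stdSimplex ℝ x

lemma mul [Fintype β] [Fintype γ] {W : Matrix α β ℝ} {V : Matrix β γ ℝ} (hW : IsStochastic W)
    (hV : IsStochastic V) : IsStochastic (W * V) := by
  refine fun x => ⟨fun z => Finset.sum_nonneg fun y _ => mul_nonneg (hW.nonneg x y) (hV.nonneg y z),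
    ?_⟩
  simp only [Matrix.mul_apply]
  rw [Finset.sum_comm]
  simp only [← Finset.mul_sum, hV.sum_eq_one, mul_one, hW.sum_eq_one]

lemma list_prod [Fintype α] [DecidableEq α] {Ws : List (Matrix α α ℝ)}
    (hWs : ∀ W ∈ Ws, IsStochastic W) : IsStochastic Ws.prod :=
  List.prod_induction IsStochastic (fun _ _ => mul) one hWs

lemma submatrix [Fintype β] {W : Matrix α β ℝ} (hW : IsStochastic W) (φ : γ → α) :
    IsStochastic (W.submatrix φ id) :=
  fun x => hW (φ x)

lemma apply_self_eq {C : Matrix Bool Bool ℝ} (hC : IsStochastic C) (θ : Bool) :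
    C θ θ = 1 - C θ (!θ) := by
  rw [eq_sub_iff_add_eq, ← hC.sum_eq_one θ, Fintype.sum_bool]
  cases θ
  · exact add_comm _ _
  · rfl

end IsStochastic

/-- The transition matrix of the noiseless channel that maps `x` to `φ x`. -/
def deterministic [DecidableEq β] (φ : α → β) : Matrix α β ℝ :=
  (1 : Matrix β β ℝ).submatrix φ id

lemma deterministic_apply [DecidableEq β] (φ : α → β) (x : α) (y : β) :
    deterministic φ x y = if φ x = y then 1 else 0 := by
  rw [deterministic, submatrix_apply, Matrix.one_apply, id]

lemma isStochastic_deterministic [Fintype β] [DecidableEq β] (φ : α → β) :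
    IsStochastic (deterministic φ) :=
  IsStochastic.one.submatrix φ

lemma deterministic_mul [Fintype β] [DecidableEq β] (φ : α → β) (W : Matrix β γ ℝ) :
    deterministic φ * W = W.submatrix φ id :=
  one_submatrix_mul φ (Equiv.refl β) W

lemma deterministic_mul_deterministic [Fintype β] [DecidableEq β] [DecidableEq γ]
    (φ : α → β) (ψ : β → γ) : deterministic φ * deterministic ψ = deterministic (ψ ∘ φ) :=
  deterministic_mul φ _

lemma mul_deterministic_apply [Fintype β] [DecidableEq γ] (W : Matrix α β ℝ) (φ : β → γ) (x : α)
    (z : γ) : (W * deterministic φ) x z = ∑ y with φ y = z, W x y := by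
  simp only [Matrix.mul_apply, deterministic_apply, mul_ite, mul_one, mul_zero, Finset.sum_filter]

/-- The transition matrix of independent uses, indexed by `ι`, of the channel `W`. -/
def memoryless (ι : Type*) [Fintype ι] (W : Matrix α β ℝ) : Matrix (ι → α) (ι → β) ℝ :=
  of fun X Y => ∏ i, W (X i) (Y i)

section Memoryless

variable [Fintype ι]

lemma memoryless_apply (W : Matrix α β ℝ) (X : ι → α) (Y : ι → β) :
    memoryless ι W X Y = ∏ i, W (X i) (Y i) := rfl

lemma IsStochastic.memoryless [DecidableEq ι] [Fintype β] {W : Matrix α β ℝ}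
    (hW : IsStochastic W) : IsStochastic (memoryless ι W) := by
  refine fun X => ⟨fun Y => Finset.prod_nonneg fun i _ => hW.nonneg (X i) (Y i), ?_⟩
  simp only [memoryless_apply, ← Fintype.prod_sum, hW.sum_eq_one, Finset.prod_const_one]

lemma memoryless_mul [DecidableEq ι] [Fintype β] (W : Matrix α β ℝ) (V : Matrix β γ ℝ) :
    memoryless ι (W * V) = memoryless ι W * memoryless ι V := by
  ext X Z
  simp only [memoryless_apply, Matrix.mul_apply, Fintype.prod_sum, Finset.prod_mul_distrib]

lemma memoryless_deterministic [DecidableEq β] (φ : α → β) :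
    memoryless ι (deterministic φ) = deterministic (φ ∘ ·) := by
  ext X Y
  simp only [memoryless_apply, deterministic_apply, Fintype.prod_boole, funext_iff,
    Function.comp_apply]

lemma memoryless_one [DecidableEq α] : memoryless ι (1 : Matrix α α ℝ) = 1 :=
  memoryless_deterministic id

lemma memoryless_mul_deterministic_comp [Fintype κ] [DecidableEq ι] [DecidableEq κ] [Fintype α]
    [Fintype β] [DecidableEq α] [DecidableEq β] {W : Matrix α β ℝ} (hW : IsStochastic W) {e : κ → ι}
    (he : Function.Injective e) :
    memoryless ι W * deterministic (fun Y : ι → β => Y ∘ e) =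
      deterministic (fun X : ι → α => X ∘ e) * memoryless κ W := by
  ext X h
  let s : ι → Finset β := Function.extend e (fun k => {h k}) fun _ => Finset.univ
  have hs : (Finset.univ.filter fun Y : ι → β => Y ∘ e = h) = Fintype.piFinset s := by
    ext Y
    simp only [Finset.mem_filter_univ, Fintype.mem_piFinset, funext_iff, Function.comp_apply]
    refine ⟨fun hY i => ?_, fun hY k => ?_⟩
    · by_cases hi : ∃ k, e k = i
      · obtain ⟨k, rfl⟩ := hi
        simp [s, he.extend_apply, hY k]
      · simp [s, Function.extend_apply' _ _ _ hi]
    · simpa [s, he.extend_apply] using hY (e k)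
  rw [mul_deterministic_apply, hs, deterministic_mul, submatrix_apply, id]
  simp only [memoryless_apply, ← Finset.prod_univ_sum]
  refine (Finset.prod_of_injOn e he.injOn (by simp) (fun i _ hi => ?_) fun k _ => ?_).symm
  · rw [show s i = Finset.univ from Function.extend_apply' _ _ _ (by simpa using hi)]
    exact hW.sum_eq_one (X i)
  · rw [show s (e k) = {h k} from he.extend_apply _ _ _, Finset.sum_singleton]
    rfl

end Memoryless

end Stochastic

section Transmit

variable {ι κ α β : Type*} [Fintype ι] {p : ℝ}

/-- The transition matrix of the binary symmetric channel. -/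
def bscMatrix (p : ℝ) : Matrix Bool Bool ℝ :=
  of (bsc p)

lemma isStochastic_bscMatrix (h0 : 0 ≤ p) (h1 : p ≤ 1) : IsStochastic (bscMatrix p) := by
  refine fun x => ⟨fun y => ?_, ?_⟩
  · rw [bscMatrix, of_apply, bsc]
    split_ifs <;> linarith
  · cases x <;> simp [bscMatrix, bsc]

/-- The transition matrix from `x` to the output of the memoryless binary symmetric channel whose
input is the block `f x`. -/
def transmit (p : ℝ) (f : α → ι → Bool) : Matrix α (ι → Bool) ℝ :=
  (memoryless ι (bscMatrix p)).submatrix f id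

lemma transmit_apply (p : ℝ) (f : α → ι → Bool) (x : α) (y : ι → Bool) :
    transmit p f x y = ∏ i, bsc p (f x i) (y i) := rfl

lemma deterministic_mul_transmit [Fintype β] [DecidableEq β] (p : ℝ) (φ : α → β)
    (f : β → ι → Bool) : deterministic φ * transmit p f = transmit p (f ∘ φ) :=
  deterministic_mul φ _

variable [DecidableEq ι]

lemma isStochastic_transmit (h0 : 0 ≤ p) (h1 : p ≤ 1) (f : α → ι → Bool) :
    IsStochastic (transmit p f) :=
  (isStochastic_bscMatrix h0 h1).memoryless.submatrix f

lemma transmit_mul_deterministic_comp [Fintype κ] (h0 : 0 ≤ p) (h1 : p ≤ 1)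
    (f : α → ι → Bool) {e : κ → ι} (he : Function.Injective e) :
    transmit p f * deterministic (fun Y : ι → Bool => Y ∘ e) = transmit p fun x => f x ∘ e := by
  classical
  have h := memoryless_mul_deterministic_comp (isStochastic_bscMatrix h0 h1) he
  rw [deterministic_mul] at h
  exact congrArg (submatrix · f id) h

end Transmit

section Protocol

variable {ι : Type*} [Fintype ι] [DecidableEq ι] {p : ℝ} {r n : ℕ}

/-- The law of the decoded bit given the message bit, for a chain with encoder `enc`, decoder `dec`
and relays that turn each received block into the next transmitted one by the maps `fs`. -/
def confusion (p : ℝ) (enc : Bool → ι → Bool) (fs : List ((ι → Bool) → ι → Bool))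
    (dec : (ι → Bool) → Bool) : Matrix Bool Bool ℝ :=
  transmit p enc * (fs.map (transmit p)).prod * deterministic dec

lemma isStochastic_chain (h0 : 0 ≤ p) (h1 : p ≤ 1) (enc : Bool → ι → Bool)
    (fs : List ((ι → Bool) → ι → Bool)) :
    IsStochastic (transmit p enc * (fs.map (transmit p)).prod) :=
  (isStochastic_transmit h0 h1 enc).mul <| .list_prod <| by
    simpa using fun f _ => isStochastic_transmit h0 h1 f

lemma isStochastic_confusion (h0 : 0 ≤ p) (h1 : p ≤ 1) (enc : Bool → ι → Bool)
    (fs : List ((ι → Bool) → ι → Bool)) (dec : (ι → Bool) → Bool) :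
    IsStochastic (confusion p enc fs dec) :=
  (isStochastic_chain h0 h1 enc fs).mul (isStochastic_deterministic dec)

/-- `f` computes each output bit from the input bits that come less than `d` positions after it. -/
def Causal (d : ℕ) (f : (Fin n → Bool) → Fin n → Bool) : Prop :=
  ∀ (i : Fin n) (c₁ c₂ : Fin n → Bool),
    (∀ k : Fin n, (k : ℕ) < i + d → c₁ k = c₂ k) → f c₁ i = f c₂ i

lemma Causal.of_le {d : ℕ} (hd : n ≤ d) (f : (Fin n → Bool) → Fin n → Bool) : Causal d f :=
  fun _ _ _ h => congrArg (f · _) (funext fun k => h k (by omega))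

/-- The block sent by relay `k` of the protocol as a function of the block it receives. -/
def Protocol.relayMap (P : Protocol r n) (k : Fin r) (c : Fin n → Bool) (i : Fin n) : Bool :=
  P.relay k i fun t => c (Fin.castLE i.isLt.le t)

lemma Protocol.relayMap_causal (P : Protocol r n) (k : Fin r) : Causal 0 (P.relayMap k) :=
  fun i _ _ h => congrArg (P.relay k i) (funext fun t => h _ t.isLt)

lemma mul_list_prod_ofFn_mul_apply {α β γ R : Type*} [Fintype β] [DecidableEq β]
    [CommSemiring R] (W : Matrix α β R) (M : Fin r → Matrix β β R) (V : Matrix β γ R) (x : α)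
    (z : γ) :
    (W * (List.ofFn M).prod * V) x z = ∑ Y : Fin (r + 1) → β,
      W x (Y 0) * (∏ k, M k (Y k.castSucc) (Y k.succ)) * V (Y (Fin.last r)) z := by
  induction r generalizing W with
  | zero =>
    rw [← (Equiv.funUnique (Fin 1) β).symm.sum_comp]
    simp [Matrix.mul_apply]
  | succ r ih =>
    rw [List.ofFn_succ, List.prod_cons, ← Matrix.mul_assoc W, ih,
      ← (Fin.consEquiv fun _ : Fin (r + 2) => β).sum_comp, Fintype.sum_prod_type, Finset.sum_comm]
    refine Finset.sum_congr rfl fun Y _ => ?_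
    simp only [Fin.consEquiv, Equiv.coe_fn_mk, Fin.prod_univ_succ (n := r), Fin.castSucc_zero,
      Fin.cons_zero, Fin.cons_succ, ← Fin.succ_last, ← Fin.succ_castSucc, Matrix.mul_apply,
      Finset.sum_mul, mul_assoc]

lemma Protocol.outputProb_eq_prod_transmit (P : Protocol r n) (p : ℝ) (θ : Bool)
    (y : Fin n → Fin (r + 1) → Bool) :
    P.outputProb p θ y = transmit p P.encode θ (fun i => y i 0) *
      ∏ k : Fin r, transmit p (P.relayMap k) (fun i => y i k.castSucc) (fun i => y i k.succ) := by
  rw [Protocol.outputProb, Finset.prod_comm, Fin.prod_univ_succ]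
  rfl

lemma Protocol.errorProb_eq_sum_confusion (P : Protocol r n) (p : ℝ) :
    P.errorProb p =
      ∑ θ, 1 / 2 * confusion p P.encode (List.ofFn P.relayMap) P.decode θ (!θ) := by
  refine Finset.sum_congr rfl fun θ _ => congrArg (1 / 2 * ·) ?_
  rw [confusion, List.map_ofFn, mul_list_prod_ofFn_mul_apply,
    ← (Equiv.piComm fun (_ : Fin n) (_ : Fin (r + 1)) => Bool).sum_comp]
  refine Finset.sum_congr rfl fun y _ => ?_
  simp only [outputProb_eq_prod_transmit, deterministic_apply, Bool.eq_not, mul_ite, mul_one,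
    mul_zero]
  rfl

lemma exists_protocol_errorProb_eq (p : ℝ) (enc : Bool → Fin n → Bool)
    (fs : List ((Fin n → Bool) → Fin n → Bool)) (hfs : ∀ f ∈ fs, Causal 0 f)
    (dec : (Fin n → Bool) → Bool) :
    ∃ P : Protocol fs.length n, P.errorProb p = ∑ θ, 1 / 2 * confusion p enc fs dec θ (!θ) := by
  let P : Protocol fs.length n :=
    { encode := enc
      relay := fun k i h => fs.get k (fun t => if ht : (t : ℕ) < i then h ⟨t, ht⟩ else false) i
      decode := dec }
  have hP : P.relayMap = fs.get := by
    funext k c i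
    exact hfs _ (List.get_mem fs k) i _ _ fun t ht => dif_pos ht
  exact ⟨P, by rw [P.errorProb_eq_sum_confusion, hP, List.ofFn_get]⟩

end Protocol

section ChiInfo

variable {α β : Type*} [Fintype α] [Fintype β]

/-- The chi-squared information that the output of the channel `W` carries about a uniform input
bit, up to the factor `1 / 2`; it measures how distinguishable the two rows of `W` are. -/
noncomputable def chiInfo (W : Matrix Bool α ℝ) : ℝ :=
  ∑ x, (W false x - W true x) ^ 2 / (W false x + W true x)

lemma abs_sub_le_add_of_nonneg {a b : ℝ} (ha : 0 ≤ a) (hb : 0 ≤ b) : |a - b| ≤ a + b :=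
  abs_sub_le_iff.2 ⟨by linarith, by linarith⟩

lemma sq_div_mul_self_of_abs_le {d s : ℝ} (h : |d| ≤ s) : d ^ 2 / s * s = d ^ 2 := by
  rcases eq_or_ne s 0 with rfl | hs
  · rw [abs_nonpos_iff.1 h]
    simp
  · exact div_mul_cancel₀ _ hs

lemma chiInfo_submatrix_equiv (W : Matrix Bool α ℝ) (e : β ≃ α) :
    chiInfo (W.submatrix id e) = chiInfo W :=
  e.sum_comp fun x => (W false x - W true x) ^ 2 / (W false x + W true x)

lemma sq_sum_abs_sub_le_chiInfo_mul {W : Matrix Bool α ℝ} (hW : ∀ θ x, 0 ≤ W θ x) :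
    (∑ x, |W false x - W true x|) ^ 2 ≤ chiInfo W * ∑ x, (W false x + W true x) := by
  refine Finset.sum_sq_le_sum_mul_sum_of_sq_le_mul _
    (fun x _ => div_nonneg (sq_nonneg _) (add_nonneg (hW _ x) (hW _ x)))
    (fun x _ => add_nonneg (hW _ x) (hW _ x)) fun x _ => le_of_eq ?_
  rw [sq_abs, sq_div_mul_self_of_abs_le (abs_sub_le_add_of_nonneg (hW _ x) (hW _ x))]

lemma IsStochastic.chiInfo_le_two {W : Matrix Bool α ℝ} (hW : IsStochastic W) :
    chiInfo W ≤ 2 := by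
  have hle (x : α) :
      (W false x - W true x) ^ 2 / (W false x + W true x) ≤ W false x + W true x := by
    have hf := hW.nonneg false x
    have ht := hW.nonneg true x
    exact div_le_of_le_mul₀ (by positivity) (by positivity) (by nlinarith [mul_nonneg hf ht])
  calc chiInfo W ≤ ∑ x, (W false x + W true x) := Finset.sum_le_sum fun x _ => hle x
    _ = 2 := by rw [Finset.sum_add_distrib, hW.sum_eq_one, hW.sum_eq_one]; norm_num

lemma IsStochastic.chiInfo_eq_zero [Unique α] {W : Matrix Bool α ℝ} (hW : IsStochastic W) :
    chiInfo W = 0 := by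
  have h (θ : Bool) : W θ default = 1 := by simpa using hW.sum_eq_one θ
  simp [chiInfo, h]

lemma chiInfo_mul_le {W : Matrix Bool α ℝ} {V : Matrix α β ℝ} (hW : ∀ θ x, 0 ≤ W θ x)
    (hV : IsStochastic V) : chiInfo (W * V) ≤ chiInfo W := by
  have hterm (x : α) (y : β) :
      0 ≤ (W false x - W true x) ^ 2 / (W false x + W true x) * V x y :=
    mul_nonneg (div_nonneg (sq_nonneg _) (add_nonneg (hW _ x) (hW _ x))) (hV.nonneg x y)
  have hsum (x : α) (y : β) : 0 ≤ (W false x + W true x) * V x y :=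
    mul_nonneg (add_nonneg (hW _ x) (hW _ x)) (hV.nonneg x y)
  have hy (y : β) : ((W * V) false y - (W * V) true y) ^ 2 / ((W * V) false y + (W * V) true y) ≤
      ∑ x, (W false x - W true x) ^ 2 / (W false x + W true x) * V x y := by
    simp only [Matrix.mul_apply, ← Finset.sum_sub_distrib, ← Finset.sum_add_distrib, ← sub_mul,
      ← add_mul]
    refine div_le_of_le_mul₀ (Finset.sum_nonneg fun x _ => hsum x y)
      (Finset.sum_nonneg fun x _ => hterm x y) <| Finset.sum_sq_le_sum_mul_sum_of_sq_le_mul _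
        (fun x _ => hterm x y) (fun x _ => hsum x y) fun x _ => le_of_eq ?_
    linear_combination
      -V x y ^ 2 * sq_div_mul_self_of_abs_le (abs_sub_le_add_of_nonneg (hW false x) (hW true x))
  calc chiInfo (W * V)
      ≤ ∑ y, ∑ x, (W false x - W true x) ^ 2 / (W false x + W true x) * V x y :=
        Finset.sum_le_sum fun y _ => hy y
    _ = chiInfo W := by
        rw [Finset.sum_comm]
        simp only [← Finset.mul_sum, hV.sum_eq_one, mul_one, chiInfo]

end ChiInfo

section Contraction

variable {p : ℝ}

/-- The parallel axis theorem for the weights `A`, `B` and the values `u / A`, `v / B`. -/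
lemma sq_div_add_sq_div {u v A B : ℝ} (hA : 0 < A) (hB : 0 < B) :
    u ^ 2 / A + v ^ 2 / B =
      (u + v) ^ 2 / (A + B) + (u * B - v * A) ^ 2 / (A * B * (A + B)) := by
  field_simp
  ring

lemma mul_sq_div_mul (k d s : ℝ) : (k * d) ^ 2 / (k * s) = k * (d ^ 2 / s) := by
  rw [mul_pow, mul_div_mul_comm, sq k, mul_self_div_self]

lemma bsc_contraction_of_pos (h0 : 0 ≤ p) (h1 : p ≤ 1) (d₀ d₁ : ℝ) {s₀ s₁ : ℝ} (h₀ : 0 < s₀)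
    (h₁ : 0 < s₁) :
    ((1 - p) * d₀ + p * d₁) ^ 2 / ((1 - p) * s₀ + p * s₁) +
        (p * d₀ + (1 - p) * d₁) ^ 2 / (p * s₀ + (1 - p) * s₁) ≤
      (1 - (1 - 2 * p) ^ 2) * ((d₀ + d₁) ^ 2 / (s₀ + s₁)) +
        (1 - 2 * p) ^ 2 * (d₀ ^ 2 / s₀ + d₁ ^ 2 / s₁) := by
  set A := (1 - p) * s₀ + p * s₁ with hA
  set B := p * s₀ + (1 - p) * s₁ with hB
  have hq : 0 ≤ 1 - p := sub_nonneg.2 h1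
  have hApos : 0 < A := by rcases h0.eq_or_lt with rfl | hp <;> [simpa [hA]; positivity]
  have hBpos : 0 < B := by rcases h0.eq_or_lt with rfl | hp <;> [simpa [hB]; positivity]
  have hAB : s₀ * s₁ ≤ A * B := by
    have : A * B = s₀ * s₁ + p * (1 - p) * (s₀ - s₁) ^ 2 := by ring
    rw [this]
    exact le_add_of_nonneg_right (by positivity)
  have hvar : ((1 - p) * d₀ + p * d₁) * B - (p * d₀ + (1 - p) * d₁) * A =
      (1 - 2 * p) * (d₀ * s₁ - d₁ * s₀) := by ring
  have hle : ((1 - 2 * p) * (d₀ * s₁ - d₁ * s₀)) ^ 2 / (A * B * (s₀ + s₁)) ≤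
      (1 - 2 * p) ^ 2 * ((d₀ * s₁ - d₁ * s₀) ^ 2 / (s₀ * s₁ * (s₀ + s₁))) := by
    rw [mul_pow, mul_div_assoc]
    gcongr
  rw [sq_div_add_sq_div hApos hBpos, sq_div_add_sq_div h₀ h₁, hvar,
    show A + B = s₀ + s₁ by ring, show (1 - p) * d₀ + p * d₁ + (p * d₀ + (1 - p) * d₁) = d₀ + d₁ by
      ring]
  linarith

lemma bsc_contraction (h0 : 0 ≤ p) (h1 : p ≤ 1) {d₀ d₁ s₀ s₁ : ℝ} (h₀ : |d₀| ≤ s₀)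
    (h₁ : |d₁| ≤ s₁) :
    ((1 - p) * d₀ + p * d₁) ^ 2 / ((1 - p) * s₀ + p * s₁) +
        (p * d₀ + (1 - p) * d₁) ^ 2 / (p * s₀ + (1 - p) * s₁) ≤
      (1 - (1 - 2 * p) ^ 2) * ((d₀ + d₁) ^ 2 / (s₀ + s₁)) +
        (1 - 2 * p) ^ 2 * (d₀ ^ 2 / s₀ + d₁ ^ 2 / s₁) := by
  rcases ((abs_nonneg d₀).trans h₀).eq_or_lt with rfl | hs₀
  · obtain rfl : d₀ = 0 := abs_nonpos_iff.1 h₀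
    simp only [mul_zero, zero_add, mul_sq_div_mul, div_zero]
    linarith
  rcases ((abs_nonneg d₁).trans h₁).eq_or_lt with rfl | hs₁
  · obtain rfl : d₁ = 0 := abs_nonpos_iff.1 h₁
    simp only [mul_zero, add_zero, mul_sq_div_mul, div_zero]
    linarith
  exact bsc_contraction_of_pos h0 h1 d₀ d₁ hs₀ hs₁

open scoped Kronecker

lemma chiInfo_mul_bscMatrix_kronecker_one_le {β : Type*} [Fintype β] [DecidableEq β]
    (h0 : 0 ≤ p) (h1 : p ≤ 1) {U : Matrix Bool (Bool × β) ℝ} (hU : ∀ θ x, 0 ≤ U θ x) :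
    chiInfo (U * bscMatrix p ⊗ₖ (1 : Matrix β β ℝ)) ≤
      (1 - (1 - 2 * p) ^ 2) * chiInfo (U * deterministic (Prod.snd : Bool × β → β)) +
        (1 - 2 * p) ^ 2 * chiInfo U := by
  have hsnd (θ : Bool) (h : β) : (U * deterministic (Prod.snd : Bool × β → β)) θ h =
      U θ (false, h) + U θ (true, h) := by
    simp [Matrix.mul_apply, Fintype.sum_prod_type, deterministic_apply, add_comm]
  have hnoise (θ z : Bool) (h : β) : (U * bscMatrix p ⊗ₖ (1 : Matrix β β ℝ)) θ (z, h) =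
      bsc p false z * U θ (false, h) + bsc p true z * U θ (true, h) := by
    simp [Matrix.mul_apply, Fintype.sum_prod_type, Matrix.one_apply, bscMatrix, mul_comm, add_comm]
  have hbsc : bsc p false false = 1 - p ∧ bsc p false true = p ∧ bsc p true false = p ∧
      bsc p true true = 1 - p := by simp [bsc]
  have hsub (s t a b c d : ℝ) : s * a + t * c - (s * b + t * d) = s * (a - b) + t * (c - d) := by
    ring
  have hadd (s t a b c d : ℝ) : s * a + t * c + (s * b + t * d) = s * (a + b) + t * (c + d) := by
    ring
  simp only [chiInfo, Fintype.sum_prod_type_right, Fintype.sum_bool, hsnd, hnoise, hbsc, hsub,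
    hadd, add_sub_add_comm, Finset.mul_sum, ← Finset.sum_add_distrib]
  refine Finset.sum_le_sum fun h _ => ?_
  have hle := bsc_contraction h0 h1
    (abs_sub_le_add_of_nonneg (hU false (false, h)) (hU true (false, h)))
    (abs_sub_le_add_of_nonneg (hU false (true, h)) (hU true (true, h)))
  rw [add_add_add_comm]
  linarith

end Contraction

section Recursion

variable {α : Type*} {p : ℝ} {i n : ℕ}

open scoped Kronecker

/-- The channel `transmit p g` before the noise has acted on the last bit, which is listed
separately. -/
def transmitInit (p : ℝ) (g : α → Fin (i + 1) → Bool) : Matrix α (Bool × (Fin i → Bool)) ℝ :=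
  of fun x y => if g x (Fin.last i) = y.1 then transmit p (fun x => Fin.init (g x)) x y.2 else 0

lemma isStochastic_transmitInit (h0 : 0 ≤ p) (h1 : p ≤ 1) (g : α → Fin (i + 1) → Bool) :
    IsStochastic (transmitInit p g) := by
  have h := isStochastic_transmit h0 h1 fun x => Fin.init (g x)
  refine fun x => ⟨fun y => ite_nonneg (h.nonneg x y.2) le_rfl, ?_⟩
  simp [transmitInit, Fintype.sum_prod_type_right, h.sum_eq_one x]

lemma transmitInit_mul_deterministic_snd (p : ℝ) (g : α → Fin (i + 1) → Bool) :
    transmitInit p g * deterministic (Prod.snd : Bool × (Fin i → Bool) → Fin i → Bool) =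
      transmit p fun x => Fin.init (g x) := by
  ext x h
  simp [transmitInit, Matrix.mul_apply, deterministic_apply, Fintype.sum_prod_type_right]

lemma transmitInit_mul_bscMatrix_kronecker_one (p : ℝ) (g : α → Fin (i + 1) → Bool) :
    transmitInit p g * bscMatrix p ⊗ₖ (1 : Matrix (Fin i → Bool) _ ℝ) =
      (transmit p g).submatrix id (Fin.snocEquiv fun _ => Bool) := by
  ext x ⟨z, h⟩
  simp [transmitInit, Matrix.mul_apply, Fintype.sum_prod_type_right, Matrix.one_apply,
    transmit_apply, Fin.prod_univ_castSucc, Fin.init, bscMatrix]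

/-- Transmitting one more bit: conditionally on the first `i` outputs, the last output is a noisy
version of a function of `x`. -/
lemma chiInfo_mul_transmit_le [Fintype α] (h0 : 0 ≤ p) (h1 : p ≤ 1) {W : Matrix Bool α ℝ}
    (hW : IsStochastic W) (g : α → Fin (i + 1) → Bool) :
    chiInfo (W * transmit p g) ≤
      (1 - (1 - 2 * p) ^ 2) * chiInfo (W * transmit p fun x => Fin.init (g x)) +
        (1 - 2 * p) ^ 2 * chiInfo W := by
  have hg := isStochastic_transmitInit h0 h1 g
  have hle := chiInfo_mul_bscMatrix_kronecker_one_le h0 h1 (hW.mul hg).nonneg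
  rw [Matrix.mul_assoc, Matrix.mul_assoc, transmitInit_mul_bscMatrix_kronecker_one,
    transmitInit_mul_deterministic_snd] at hle
  rw [← chiInfo_submatrix_equiv (W * transmit p g) (Fin.snocEquiv fun _ => Bool),
    submatrix_mul W (transmit p g) id id _ Function.bijective_id, submatrix_id_id]
  refine hle.trans ?_
  gcongr
  exact chiInfo_mul_le hW.nonneg hg

/-- The noiseless channel that keeps the first `i` bits of a block. -/
def prefixMatrix (h : i ≤ n) : Matrix (Fin n → Bool) (Fin i → Bool) ℝ :=
  deterministic fun c => c ∘ Fin.castLE h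

lemma isStochastic_prefixMatrix (h : i ≤ n) : IsStochastic (prefixMatrix h) :=
  isStochastic_deterministic _

lemma transmit_mul_prefixMatrix (h0 : 0 ≤ p) (h1 : p ≤ 1) (f : α → Fin n → Bool) (h : i ≤ n) :
    transmit p f * prefixMatrix h = transmit p fun x => f x ∘ Fin.castLE h :=
  transmit_mul_deterministic_comp h0 h1 f (Fin.castLE_injective h)

lemma Causal.exists_comp_castLE_eq {f : (Fin n → Bool) → Fin n → Bool} (hf : Causal 0 f)
    (h : i + 1 ≤ n) : ∃ g : (Fin i → Bool) → Fin (i + 1) → Bool,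
      ∀ c, f c ∘ Fin.castLE h = g (c ∘ Fin.castLE (Nat.le_of_succ_le h)) := by
  refine ⟨fun u j => f (fun k => if hk : (k : ℕ) < i then u ⟨k, hk⟩ else false) (Fin.castLE h j),
    fun c => funext fun j => hf _ _ _ fun k hk => ?_⟩
  have hk' : (k : ℕ) < i := hk.trans_le (Nat.le_of_lt_succ j.isLt)
  rw [dif_pos hk']
  rfl

lemma Causal.chiInfo_prefix_succ_le (h0 : 0 ≤ p) (h1 : p ≤ 1) {W : Matrix Bool (Fin n → Bool) ℝ}
    (hW : IsStochastic W) {f : (Fin n → Bool) → Fin n → Bool} (hf : Causal 0 f)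
    (h : i + 1 ≤ n) :
    chiInfo (W * transmit p f * prefixMatrix h) ≤
      (1 - (1 - 2 * p) ^ 2) *
          chiInfo (W * transmit p f * prefixMatrix (Nat.le_of_succ_le h)) +
        (1 - 2 * p) ^ 2 * chiInfo (W * prefixMatrix (Nat.le_of_succ_le h)) := by
  obtain ⟨g, hg⟩ := hf.exists_comp_castLE_eq h
  have hinit (c : Fin n → Bool) : f c ∘ Fin.castLE (Nat.le_of_succ_le h) =
      Fin.init (g (c ∘ Fin.castLE (Nat.le_of_succ_le h))) := by
    rw [← hg]
    rfl
  have hle := chiInfo_mul_transmit_le h0 h1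
    (hW.mul (isStochastic_prefixMatrix (Nat.le_of_succ_le h))) g
  simp only [prefixMatrix, Matrix.mul_assoc, deterministic_mul_transmit] at hle
  simp only [Matrix.mul_assoc, transmit_mul_prefixMatrix h0 h1, hg, hinit]
  exact hle

lemma Causal.chiInfo_prefix_le (h0 : 0 ≤ p) (h1 : p ≤ 1) {W : Matrix Bool (Fin n → Bool) ℝ}
    (hW : IsStochastic W) {f : (Fin n → Bool) → Fin n → Bool} (hf : Causal 0 f) {B : ℝ}
    (hB : ∀ i (h : i ≤ n), chiInfo (W * prefixMatrix h) ≤ B * (1 + (1 - 2 * p) ^ 2) ^ i)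
    (h : i ≤ n) :
    chiInfo (W * transmit p f * prefixMatrix h) ≤ B / 2 * (1 + (1 - 2 * p) ^ 2) ^ i := by
  induction i with
  | zero =>
    have hzero := hB 0 h
    rw [(hW.mul (isStochastic_prefixMatrix h)).chiInfo_eq_zero] at hzero
    have hWf := hW.mul (isStochastic_transmit h0 h1 f)
    rw [(hWf.mul (isStochastic_prefixMatrix h)).chiInfo_eq_zero]
    linarith
  | succ i ih =>
    have hη : 0 ≤ 1 - (1 - 2 * p) ^ 2 := by nlinarith
    calc chiInfo (W * transmit p f * prefixMatrix h)
        ≤ (1 - (1 - 2 * p) ^ 2) * (B / 2 * (1 + (1 - 2 * p) ^ 2) ^ i) +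
            (1 - 2 * p) ^ 2 * (B * (1 + (1 - 2 * p) ^ 2) ^ i) := by
          grw [hf.chiInfo_prefix_succ_le h0 h1 hW h, ih, hB]
      _ = B / 2 * (1 + (1 - 2 * p) ^ 2) ^ (i + 1) := by ring

lemma chiInfo_chain_prefix_le (h0 : 0 ≤ p) (h1 : p ≤ 1) {W : Matrix Bool (Fin n → Bool) ℝ}
    (hW : IsStochastic W) {fs : List ((Fin n → Bool) → Fin n → Bool)}
    (hfs : ∀ f ∈ fs, Causal 0 f) {B : ℝ}
    (hB : ∀ i (h : i ≤ n), chiInfo (W * prefixMatrix h) ≤ B * (1 + (1 - 2 * p) ^ 2) ^ i)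
    (h : i ≤ n) :
    chiInfo (W * (fs.map (transmit p)).prod * prefixMatrix h) ≤
      B / 2 ^ fs.length * (1 + (1 - 2 * p) ^ 2) ^ i := by
  induction fs generalizing W B with
  | nil => simpa using hB i h
  | cons f fs ih =>
    obtain ⟨hf, hfs⟩ := List.forall_mem_cons.1 hfs
    rw [List.map_cons, List.prod_cons, ← Matrix.mul_assoc W, List.length_cons, pow_succ', ← div_div]
    exact ih (hW.mul (isStochastic_transmit h0 h1 f)) hfs
      fun i h => hf.chiInfo_prefix_le h0 h1 hW hB h

lemma chiInfo_confusion_le (h0 : 0 ≤ p) (h1 : p ≤ 1) (enc : Bool → Fin n → Bool)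
    {fs : List ((Fin n → Bool) → Fin n → Bool)} (hfs : ∀ f ∈ fs, Causal 0 f)
    (dec : (Fin n → Bool) → Bool) :
    chiInfo (confusion p enc fs dec) ≤ 2 / 2 ^ fs.length * (1 + (1 - 2 * p) ^ 2) ^ n := by
  have hid : prefixMatrix (le_refl n) = 1 := rfl
  have henc := isStochastic_transmit h0 h1 enc
  calc chiInfo (confusion p enc fs dec) ≤ chiInfo (transmit p enc * (fs.map (transmit p)).prod) :=
        chiInfo_mul_le (isStochastic_chain h0 h1 enc fs).nonneg (isStochastic_deterministic dec)
    _ = chiInfo (transmit p enc * (fs.map (transmit p)).prod * prefixMatrix (le_refl n)) := by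
        rw [hid, Matrix.mul_one]
    _ ≤ 2 / 2 ^ fs.length * (1 + (1 - 2 * p) ^ 2) ^ n :=
        chiInfo_chain_prefix_le h0 h1 henc hfs (fun i h =>
          (henc.mul (isStochastic_prefixMatrix h)).chiInfo_le_two.trans <|
            le_mul_of_one_le_right zero_le_two (one_le_pow₀ (by nlinarith [sq_nonneg (1 - 2 * p)])))
          le_rfl

lemma IsStochastic.sq_one_sub_error_le_chiInfo {C : Matrix Bool Bool ℝ} (hC : IsStochastic C) :
    (1 - (C false true + C true false)) ^ 2 ≤ chiInfo C / 2 := by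
  have hle := sq_sum_abs_sub_le_chiInfo_mul hC.nonneg
  simp only [Fintype.sum_bool, hC.apply_self_eq, Bool.not_true, Bool.not_false] at hle
  rw [show 1 - C false true - C true false = -(C false true - (1 - C true false)) by ring, abs_neg,
    ← two_mul, mul_pow, sq_abs] at hle
  linarith

lemma Protocol.sq_one_sub_two_mul_errorProb_le {r : ℕ} (P : Protocol r n) (h0 : 0 ≤ p)
    (h1 : p ≤ 1) : (1 - 2 * P.errorProb p) ^ 2 ≤ (1 + (1 - 2 * p) ^ 2) ^ n / 2 ^ r := by
  have hfs : ∀ f ∈ List.ofFn P.relayMap, Causal 0 f :=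
    List.forall_mem_ofFn_iff.2 P.relayMap_causal
  have hchi := chiInfo_confusion_le h0 h1 P.encode hfs P.decode
  rw [List.length_ofFn] at hchi
  set C := confusion p P.encode (List.ofFn P.relayMap) P.decode
  have herr : 2 * P.errorProb p = C false true + C true false := by
    rw [P.errorProb_eq_sum_confusion, Fintype.sum_bool, Bool.not_true, Bool.not_false]
    ring
  calc (1 - 2 * P.errorProb p) ^ 2 ≤ chiInfo C / 2 := by
        rw [herr]
        exact (isStochastic_confusion h0 h1 _ _ _).sq_one_sub_error_le_chiInfo
    _ ≤ 2 / 2 ^ r * (1 + (1 - 2 * p) ^ 2) ^ n / 2 := by gcongr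
    _ = (1 + (1 - 2 * p) ^ 2) ^ n / 2 ^ r := by ring

lemma eventually_forall_hops_le (h0 : 0 ≤ p) (h1 : p ≤ 1) {ε : ℝ} (hε : ε < 1 / 2) :
    ∀ᶠ r : ℕ in atTop, ∀ (n : ℕ) (P : Protocol r n), P.errorProb p ≤ ε →
      ((r + 1 : ℕ) : ℝ) ≤ 2 * (1 - 2 * p) ^ 2 * n := by
  have hgap : 0 < 1 - 2 * ε := by linarith
  have hlog : 0 < Real.log 2 - 1 / 2 := by linarith [Real.log_two_gt_d9]
  filter_upwards [tendsto_natCast_atTop_atTop.eventually_ge_atTop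
    ((1 / 2 - 2 * Real.log (1 - 2 * ε)) / (Real.log 2 - 1 / 2))] with r hr n P hP
  have hpow : (1 - 2 * ε) ^ 2 * 2 ^ r ≤ (1 + (1 - 2 * p) ^ 2) ^ n :=
    (le_div_iff₀ (by positivity)).1 <|
      le_trans (by gcongr) (P.sq_one_sub_two_mul_errorProb_le h0 h1)
  have hlogpow := Real.log_le_log (by positivity) hpow
  rw [Real.log_mul (by positivity) (by positivity), Real.log_pow, Real.log_pow, Real.log_pow]
    at hlogpow
  have hη : (n : ℝ) * Real.log (1 + (1 - 2 * p) ^ 2) ≤ n * (1 - 2 * p) ^ 2 := by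
    gcongr
    linarith [Real.log_le_sub_one_of_pos (x := 1 + (1 - 2 * p) ^ 2) (by positivity)]
  rw [div_le_iff₀ hlog] at hr
  push_cast at hlogpow ⊢
  linarith

end Recursion

section Repetition

variable {ι α : Type*} {p : ℝ} {R τ : ℕ}

/-- The decomposition of a block of length `R * τ` into `R` consecutive blocks of length `τ`. -/
def blockEquiv (R τ : ℕ) : (Fin (R * τ) → Bool) ≃ (Fin R → Fin τ → Bool) :=
  (finProdFinEquiv.symm.arrowCongr (Equiv.refl Bool)).trans (Equiv.curry (Fin R) (Fin τ) Bool)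

lemma blockEquiv_apply (c : Fin (R * τ) → Bool) (u : Fin R) (i : Fin τ) :
    blockEquiv R τ c u i = c (finProdFinEquiv (u, i)) := rfl

lemma blockEquiv_symm_apply (X : Fin R → Fin τ → Bool) (u : Fin R) (i : Fin τ) :
    (blockEquiv R τ).symm X (finProdFinEquiv (u, i)) = X u i := by
  rw [← blockEquiv_apply ((blockEquiv R τ).symm X), Equiv.apply_symm_apply]

/-- The juxtaposition of the `R` blocks obtained by applying `f` to each entry of a vector. -/
def juxtapose (f : α → Fin τ → Bool) (X : Fin R → α) : Fin (R * τ) → Bool :=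
  (blockEquiv R τ).symm (f ∘ X)

lemma transmit_juxtapose_mul_deterministic (p : ℝ) (f : α → Fin τ → Bool) :
    transmit p (juxtapose (R := R) f) * deterministic (blockEquiv R τ) =
      memoryless (Fin R) (transmit p f) := by
  ext X Y
  rw [mul_deterministic_apply, Finset.sum_eq_single_of_mem ((blockEquiv R τ).symm Y) (by simp)
    (by simpa [Equiv.eq_symm_apply] using fun c hc hne => absurd hc hne), transmit_apply,
    ← finProdFinEquiv.prod_comp, Fintype.prod_prod_type]
  simp only [juxtapose, blockEquiv_symm_apply, memoryless_apply, transmit_apply,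
    Function.comp_apply]

/-- The map on blocks of length `R * τ` that acts by `f` on each of the `R` consecutive blocks of
length `τ`. -/
def blockMap (R : ℕ) (f : (Fin τ → Bool) → Fin τ → Bool) :
    (Fin (R * τ) → Bool) → Fin (R * τ) → Bool :=
  juxtapose f ∘ blockEquiv R τ

lemma Causal.blockMap {d : ℕ} {f : (Fin τ → Bool) → Fin τ → Bool} (hf : Causal d f) :
    Causal d (blockMap R f) := by
  intro t c₁ c₂ h
  obtain ⟨⟨u, i⟩, rfl⟩ := finProdFinEquiv.surjective t
  simp only [BitRelay.blockMap, juxtapose, Function.comp_apply, blockEquiv_symm_apply]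
  refine hf i _ _ fun k hk => h (finProdFinEquiv (u, k)) ?_
  simp only [finProdFinEquiv_apply_val]
  omega

lemma list_prod_transmit_blockMap_mul_deterministic (p : ℝ)
    (fs : List ((Fin τ → Bool) → Fin τ → Bool)) :
    ((fs.map (blockMap R)).map (transmit p)).prod * deterministic (blockEquiv R τ) =
      deterministic (blockEquiv R τ) * memoryless (Fin R) (fs.map (transmit p)).prod := by
  induction fs with
  | nil => simp [memoryless_one]
  | cons f fs ih =>
    simp only [List.map_cons, List.prod_cons, Matrix.mul_assoc, ih, memoryless_mul]
    rw [← Matrix.mul_assoc, blockMap, ← deterministic_mul_transmit,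
      Matrix.mul_assoc (deterministic _), transmit_juxtapose_mul_deterministic, Matrix.mul_assoc]

/-- The majority of the bits `v u`; `false` in case of a tie. -/
def majority [Fintype ι] (v : ι → Bool) : Bool :=
  decide (Fintype.card ι < 2 * (Finset.univ.filter fun u => v u = true).card)

lemma confusion_blockMap (p : ℝ) (enc : Bool → Fin τ → Bool)
    (fs : List ((Fin τ → Bool) → Fin τ → Bool)) (dec : (Fin τ → Bool) → Bool) :
    confusion p (juxtapose enc ∘ Function.const (Fin R)) (fs.map (blockMap R))
        (majority ∘ (dec ∘ ·) ∘ blockEquiv R τ) =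
      deterministic (Function.const (Fin R) : Bool → Fin R → Bool) *
          memoryless (Fin R) (confusion p enc fs dec) *
        deterministic (majority : (Fin R → Bool) → Bool) := by
  rw [confusion, confusion, memoryless_mul, memoryless_mul, memoryless_deterministic,
    ← transmit_juxtapose_mul_deterministic, ← deterministic_mul_transmit,
    ← deterministic_mul_deterministic, ← deterministic_mul_deterministic]
  simp only [Matrix.mul_assoc]
  rw [← Matrix.mul_assoc (List.prod _), list_prod_transmit_blockMap_mul_deterministic]
  simp only [Matrix.mul_assoc]

lemma one_le_prod_of_majority_ne [Fintype ι] {v : ι → Bool} {θ : Bool} (h : majority v = !θ)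
    {x : ℝ} (hx : 1 ≤ x) : 1 ≤ ∏ u, if v u = θ then x⁻¹ else x := by
  have hx0 : 0 < x := by linarith
  rw [Finset.prod_ite, Finset.prod_const, Finset.prod_const]
  have hcard := Finset.card_filter_add_card_filter_not (s := Finset.univ) fun u => v u = θ
  rw [Finset.card_univ] at hcard
  set agree := (Finset.univ.filter fun u => v u = θ).card with hagree
  set differ := (Finset.univ.filter fun u => ¬ v u = θ).card with hdiffer
  have hle : agree ≤ differ := by
    cases θ
    · simp only [majority, Bool.not_false, decide_eq_true_eq, Bool.not_eq_false] at h hagree hdiffer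
      omega
    · simp only [majority, Bool.not_true, decide_eq_false_iff_not, not_lt] at h hagree hdiffer
      omega
  calc (1 : ℝ) = x⁻¹ ^ agree * x ^ agree := by rw [← mul_pow, inv_mul_cancel₀ hx0.ne', one_pow]
    _ ≤ x⁻¹ ^ agree * x ^ differ := by gcongr

lemma tilt_le {ε c : ℝ} (hε : 0 < ε) (hε2 : ε ≤ 1 / 2) (hc : c ≤ ε) :
    (1 - c) * (√(1 - ε) / √ε)⁻¹ + c * (√(1 - ε) / √ε) ≤ √(4 * ε * (1 - ε)) := by
  have hpos : 0 < √ε := Real.sqrt_pos.2 hε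
  have hle : √ε ≤ √(1 - ε) := Real.sqrt_le_sqrt (by linarith)
  have hpos' : 0 < √(1 - ε) := hpos.trans_le hle
  have hsq : √ε * √ε = ε := Real.mul_self_sqrt hε.le
  have hsq' : √(1 - ε) * √(1 - ε) = 1 - ε := Real.mul_self_sqrt (by linarith)
  calc (1 - c) * (√(1 - ε) / √ε)⁻¹ + c * (√(1 - ε) / √ε)
      ≤ (1 - ε) * (√(1 - ε) / √ε)⁻¹ + ε * (√(1 - ε) / √ε) := by
        have h1 : 1 ≤ √(1 - ε) / √ε := (one_le_div hpos).2 hle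
        nlinarith [inv_le_one_of_one_le₀ h1]
    _ = √(1 - ε) * √(1 - ε) * (√(1 - ε) / √ε)⁻¹ + √ε * √ε * (√(1 - ε) / √ε) := by rw [hsq, hsq']
    _ = 2 * √ε * √(1 - ε) := by
        field_simp
        ring
    _ = √(4 * ε * (1 - ε)) := by
        rw [Real.sqrt_mul (by positivity), Real.sqrt_mul zero_le_four,
          show (4 : ℝ) = 2 ^ 2 by norm_num, Real.sqrt_sq zero_le_two]

lemma memoryless_mul_majority_apply_not_le [Fintype ι] [DecidableEq ι]
    {C : Matrix Bool Bool ℝ} (hC : IsStochastic C) {ε : ℝ} (hε : 0 < ε) (hε2 : ε ≤ 1 / 2)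
    {θ : Bool} (hCε : C θ (!θ) ≤ ε) :
    (deterministic (Function.const ι : Bool → ι → Bool) * memoryless ι C *
      deterministic (majority : (ι → Bool) → Bool)) θ (!θ) ≤
        √(4 * ε * (1 - ε)) ^ Fintype.card ι := by
  -- Chernoff bound: a wrong vote has weight `x` and a correct one `x⁻¹`, so that a wrong majority
  -- has weight at least `1`; this `x` minimises the expected weight of a vote.
  set x := √(1 - ε) / √ε
  have hx1 : 1 ≤ x := (one_le_div (Real.sqrt_pos.2 hε)).2 (Real.sqrt_le_sqrt (by linarith))
  rw [Matrix.mul_assoc, deterministic_mul, submatrix_apply, mul_deterministic_apply, id]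
  calc ∑ V with majority V = !θ, memoryless ι C (Function.const ι θ) V
      ≤ ∑ V : ι → Bool, ∏ u, C θ (V u) * (if V u = θ then x⁻¹ else x) := by
        rw [Finset.sum_filter]
        gcongr with V
        rw [Finset.prod_mul_distrib]
        split_ifs with hV
        · exact le_mul_of_one_le_right (hC.memoryless.nonneg _ _)
            (one_le_prod_of_majority_ne hV hx1)
        · exact mul_nonneg (hC.memoryless.nonneg _ _)
            (Finset.prod_nonneg fun u _ => by split_ifs <;> positivity)
    _ = (C θ θ * x⁻¹ + C θ (!θ) * x) ^ Fintype.card ι := by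
        rw [← Fintype.prod_sum fun _ v => C θ v * if v = θ then x⁻¹ else x]
        cases θ <;> simp [add_comm]
    _ ≤ √(4 * ε * (1 - ε)) ^ Fintype.card ι := by
        have hself := hC.nonneg θ θ
        have hnot := hC.nonneg θ (!θ)
        gcongr
        rw [hC.apply_self_eq]
        exact tilt_le hε hε2 hCε

end Repetition

section Schemes

variable {p ε ε' : ℝ} {r r' D D' s s' d τ n : ℕ}

/-- With error probability at most `ε` for either message, a bit can be sent over `r + 1` hops when
each node uses a window of `τ` consecutive times, and the window of each relay starts a certain
delay after that of the preceding node. The list `L` holds the delays, whose sum is at most `D`,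
and the maps that the relays apply to the received windows. -/
def Achieves (p : ℝ) (r D τ : ℕ) (ε : ℝ) : Prop :=
  ∃ (enc : Bool → Fin τ → Bool) (L : List (ℕ × ((Fin τ → Bool) → Fin τ → Bool)))
    (dec : (Fin τ → Bool) → Bool), L.length = r ∧ (L.map Prod.fst).sum ≤ D ∧
      (∀ x ∈ L, Causal x.1 x.2) ∧ ∀ θ, confusion p enc (L.map Prod.snd) dec θ (!θ) ≤ ε

lemma Achieves.mono (h : Achieves p r D τ ε) (hD : D ≤ D') (hε : ε ≤ ε') :
    Achieves p r D' τ ε' := by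
  obtain ⟨enc, L, dec, hr, hLD, hL, he⟩ := h
  exact ⟨enc, L, dec, hr, hLD.trans hD, hL, fun θ => (he θ).trans hε⟩

lemma achieves_single (p : ℝ) : Achieves p 0 0 1 p := by
  refine ⟨fun θ _ => θ, [], fun c => c 0, rfl, le_rfl, by simp, fun θ => le_of_eq ?_⟩
  rw [confusion, List.map_nil, List.map_nil, List.prod_nil, Matrix.mul_one,
    mul_deterministic_apply, Finset.sum_filter, ← (Equiv.funUnique (Fin 1) Bool).symm.sum_comp]
  cases θ <;> simp [transmit_apply, bsc]

lemma IsStochastic.mul_apply_not_le {C C' : Matrix Bool Bool ℝ} (hC : IsStochastic C)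
    (hC' : IsStochastic C') (θ : Bool) : (C * C') θ (!θ) ≤ C θ (!θ) + C' θ (!θ) := by
  have hmul : (C * C') θ (!θ) = C θ (!θ) * C' (!θ) (!θ) + C θ θ * C' θ (!θ) := by
    rw [Matrix.mul_apply, Fintype.sum_bool]
    cases θ
    · rfl
    · exact add_comm _ _
  have h1 : C' (!θ) (!θ) ≤ 1 := by linarith [hC'.apply_self_eq (!θ), hC'.nonneg (!θ) (!!θ)]
  have h2 : C θ θ ≤ 1 := by linarith [hC.apply_self_eq θ, hC.nonneg θ (!θ)]
  rw [hmul]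
  exact add_le_add (mul_le_of_le_one_right (hC.nonneg _ _) h1)
    (mul_le_of_le_one_left (hC'.nonneg _ _) h2)

lemma confusion_append {ι : Type*} [Fintype ι] [DecidableEq ι] (p : ℝ) (enc enc' : Bool → ι → Bool)
    (fs fs' : List ((ι → Bool) → ι → Bool)) (dec dec' : (ι → Bool) → Bool) :
    confusion p enc (fs ++ (enc' ∘ dec) :: fs') dec' =
      confusion p enc fs dec * confusion p enc' fs' dec' := by
  simp only [confusion, List.map_append, List.map_cons, List.prod_append, List.prod_cons,
    ← deterministic_mul_transmit, Matrix.mul_assoc]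

lemma Achieves.concat (h0 : 0 ≤ p) (h1 : p ≤ 1) (h : Achieves p r D τ ε)
    (h' : Achieves p r' D' τ ε') : Achieves p (r + 1 + r') (D + τ + D') τ (ε + ε') := by
  obtain ⟨enc, L, dec, hr, hLD, hL, he⟩ := h
  obtain ⟨enc', L', dec', hr', hLD', hL', he'⟩ := h'
  refine ⟨enc, L ++ (τ, enc' ∘ dec) :: L', dec', ?_, ?_, ?_, fun θ => ?_⟩
  · rw [List.length_append, List.length_cons, hr, hr', add_assoc, add_comm 1]
  · rw [List.map_append, List.map_cons, List.sum_append, List.sum_cons]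
    omega
  · simpa only [List.forall_mem_append, List.forall_mem_cons] using ⟨hL, .of_le le_rfl _, hL'⟩
  · rw [List.map_append, List.map_cons, confusion_append]
    exact ((isStochastic_confusion h0 h1 _ _ _).mul_apply_not_le
      (isStochastic_confusion h0 h1 _ _ _) θ).trans (add_le_add (he θ) (he' θ))

lemma achieves_of_lt_two_mul (h0 : 0 ≤ p) (h1 : p ≤ 1) (hε : 0 ≤ ε) {N : ℕ}
    (h : ∀ r < N, Achieves p r D τ ε) (hr : r < 2 * N) : Achieves p r (2 * D + τ) τ (2 * ε) := by
  by_cases hrN : r < N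
  · exact (h r hrN).mono (by omega) (by linarith)
  · have hconcat := (h (N - 1) (by omega)).concat h0 h1 (h (r - N) (by omega))
    rw [show N - 1 + 1 + (r - N) = r by omega] at hconcat
    exact hconcat.mono (by omega) (by linarith)

lemma Achieves.repeat (h0 : 0 ≤ p) (h1 : p ≤ 1) (hε : 0 < ε) (hε2 : ε ≤ 1 / 2)
    (h : Achieves p r D τ ε) (R : ℕ) : Achieves p r D (R * τ) (√(4 * ε * (1 - ε)) ^ R) := by
  obtain ⟨enc, L, dec, hr, hLD, hL, he⟩ := h
  refine ⟨juxtapose enc ∘ Function.const (Fin R), L.map (Prod.map id (blockMap R)),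
    majority ∘ (dec ∘ ·) ∘ blockEquiv R τ, by rwa [List.length_map], ?_, ?_, fun θ => ?_⟩
  · rwa [List.map_map, Prod.map_fst', Function.id_comp]
  · exact List.forall_mem_map.2 fun x hx => (hL x hx).blockMap
  · rw [List.map_map, Prod.map_snd', ← List.map_map, confusion_blockMap]
    have hle := memoryless_mul_majority_apply_not_le (ι := Fin R)
      (isStochastic_confusion h0 h1 _ _ _) hε hε2 (he θ)
    rwa [Fintype.card_fin] at hle

/-- The embedding of a window of `τ` consecutive times, starting at time `s`, in a block. -/
def window (h : s + τ ≤ n) (i : Fin τ) : Fin n :=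
  ⟨s + i, by omega⟩

lemma window_injective (h : s + τ ≤ n) : Function.Injective (window h) := fun _ _ hij =>
  Fin.ext (Nat.add_left_cancel (congrArg Fin.val hij))

lemma Causal.exists_comp_window_eq {f : (Fin τ → Bool) → Fin τ → Bool} (hf : Causal d f)
    (h : s + τ ≤ n) (h' : s + d + τ ≤ n) : ∃ F : (Fin n → Bool) → Fin n → Bool, Causal 0 F ∧
      ∀ c, F c ∘ window h' = f (c ∘ window h) := by
  refine ⟨fun c => Function.extend (window h') (f (c ∘ window h)) fun _ => false,
    fun t c₁ c₂ hc => ?_, fun c => Function.extend_comp (window_injective h') _ _⟩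
  by_cases ht : ∃ i, window h' i = t
  · obtain ⟨i, rfl⟩ := ht
    beta_reduce
    rw [(window_injective h').extend_apply, (window_injective h').extend_apply]
    refine hf i _ _ fun k hk => hc _ ?_
    simp only [window]
    omega
  · beta_reduce
    rw [Function.extend_apply' _ _ _ ht, Function.extend_apply' _ _ _ ht]

/-- Relays working on delayed windows can be run on a common clock. -/
lemma exists_causal_chain (h0 : 0 ≤ p) (h1 : p ≤ 1)
    {L : List (ℕ × ((Fin τ → Bool) → Fin τ → Bool))} (hL : ∀ x ∈ L, Causal x.1 x.2)
    (h : s + τ ≤ n) (hs' : s + (L.map Prod.fst).sum = s') (h' : s' + τ ≤ n) :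
    ∃ Fs : List ((Fin n → Bool) → Fin n → Bool), Fs.length = L.length ∧ (∀ F ∈ Fs, Causal 0 F) ∧
      (Fs.map (transmit p)).prod * deterministic (fun c : Fin n → Bool => c ∘ window h') =
        deterministic (fun c : Fin n → Bool => c ∘ window h) *
          ((L.map Prod.snd).map (transmit p)).prod := by
  induction L generalizing s with
  | nil =>
    obtain rfl : s = s' := hs'
    exact ⟨[], rfl, by simp, (Matrix.one_mul _).trans (Matrix.mul_one _).symm⟩
  | cons x L ih =>
    obtain ⟨hx, hL⟩ := List.forall_mem_cons.1 hL
    rw [List.map_cons, List.sum_cons, ← add_assoc] at hs'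
    have hnext : s + x.1 + τ ≤ n := by omega
    obtain ⟨F, hF, hFx⟩ := hx.exists_comp_window_eq h hnext
    obtain ⟨Fs, hlen, hFs, hprod⟩ := ih hL hnext hs'
    have hstep : transmit p F * deterministic (fun c : Fin n → Bool => c ∘ window hnext) =
        deterministic (fun c : Fin n → Bool => c ∘ window h) * transmit p x.2 := by
      rw [transmit_mul_deterministic_comp h0 h1 F (window_injective hnext),
        deterministic_mul_transmit]
      exact congrArg (transmit p) (funext hFx)
    refine ⟨F :: Fs, by simp [hlen], List.forall_mem_cons.2 ⟨hF, hFs⟩, ?_⟩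
    simp only [List.map_cons, List.prod_cons]
    rw [Matrix.mul_assoc, hprod, ← Matrix.mul_assoc, hstep, Matrix.mul_assoc]

lemma Achieves.exists_protocol (h0 : 0 ≤ p) (h1 : p ≤ 1) (h : Achieves p r D τ ε) :
    ∃ P : Protocol r (D + τ), P.errorProb p ≤ ε := by
  obtain ⟨enc, L, dec, rfl, hLD, hL, he⟩ := h
  have hfirst : 0 + τ ≤ D + τ := by omega
  have hlast : (L.map Prod.fst).sum + τ ≤ D + τ := by omega
  obtain ⟨Fs, hlen, hFs, hprod⟩ := exists_causal_chain h0 h1 hL hfirst (zero_add _) hlast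
  let enc₁ (θ : Bool) : Fin (D + τ) → Bool :=
    Function.extend (window hfirst) (enc θ) fun _ => false
  let dec₁ (c : Fin (D + τ) → Bool) : Bool := dec (c ∘ window hlast)
  have henc : transmit p enc₁ * deterministic (fun c : Fin (D + τ) → Bool => c ∘ window hfirst) =
      transmit p enc := by
    rw [transmit_mul_deterministic_comp h0 h1 enc₁ (window_injective hfirst)]
    exact congrArg (transmit p) (funext fun θ =>
      Function.extend_comp (window_injective hfirst) (enc θ) _)
  have hdec : deterministic dec₁ =
      deterministic (fun c : Fin (D + τ) → Bool => c ∘ window hlast) * deterministic dec :=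
    (deterministic_mul_deterministic _ _).symm
  have hconf : confusion p enc₁ Fs dec₁ = confusion p enc (L.map Prod.snd) dec := by
    rw [confusion, hdec, ← Matrix.mul_assoc, Matrix.mul_assoc (transmit p enc₁), hprod,
      ← Matrix.mul_assoc, henc, confusion]
  obtain ⟨P, hP⟩ := exists_protocol_errorProb_eq p enc₁ Fs hFs dec₁
  rw [← hlen]
  refine ⟨P, ?_⟩
  rw [hP, hconf, Fintype.sum_bool]
  linarith [he true, he false]

end Schemes

section HighNoise

variable {p ε : ℝ} {r D τ N K : ℕ}

lemma achieves_of_lt_four_mul (h0 : 0 ≤ p) (h1 : p ≤ 1) (hε : 0 < ε) (hε7 : ε ≤ (1 / 4) ^ 7)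
    (h : ∀ r < N, Achieves p r D τ ε) (hr : r < 4 * N) :
    Achieves p r (4 * D + 9 * τ) (3 * τ) (ε / 4) := by
  have hsqrt : √ε ≤ 1 / 128 := by
    rw [Real.sqrt_le_left (by norm_num)]
    exact hε7.trans_eq (by norm_num)
  have hcube : √(4 * ε * (1 - ε)) ^ 3 ≤ ε / 16 :=
    calc √(4 * ε * (1 - ε)) ^ 3 ≤ √(2 ^ 2 * ε) ^ 3 := by
          refine pow_le_pow_left₀ (Real.sqrt_nonneg _) (Real.sqrt_le_sqrt ?_) 3
          nlinarith
      _ = 8 * √ε * ε := by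
          rw [Real.sqrt_mul (by positivity), Real.sqrt_sq zero_le_two, mul_pow, pow_succ √ε,
            Real.sq_sqrt hε.le]
          ring
      _ ≤ ε / 16 := by nlinarith
  have hε2 : ε ≤ 1 / 2 := hε7.trans (by norm_num)
  have hrepeat : ∀ r < N, Achieves p r D (3 * τ) (ε / 16) := fun r hr =>
    ((h r hr).repeat h0 h1 hε hε2 3).mono le_rfl hcube
  have hdouble : ∀ r < 2 * N, Achieves p r (2 * D + 3 * τ) (3 * τ) (2 * (ε / 16)) := fun r hr =>
    achieves_of_lt_two_mul h0 h1 (by positivity) hrepeat hr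
  exact (achieves_of_lt_two_mul h0 h1 (by positivity) hdouble (by omega)).mono (by omega)
    (by linarith)

lemma achieves_one_hop (h0 : 0 < p) (h1 : p < 1 / 2) (hK : 28 / (1 - 2 * p) ^ 2 ≤ K) :
    Achieves p 0 0 K ((1 / 4) ^ 7) := by
  have hη : 0 < (1 - 2 * p) ^ 2 := sq_pos_of_pos (by linarith)
  have hrepeat := (achieves_single p).repeat h0.le (by linarith) h0 h1.le K
  rw [mul_one] at hrepeat
  refine hrepeat.mono le_rfl ?_
  calc √(4 * p * (1 - p)) ^ K ≤ √(Real.exp (-(1 - 2 * p) ^ 2)) ^ K := by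
        gcongr
        linarith [Real.one_sub_le_exp_neg ((1 - 2 * p) ^ 2)]
    _ = Real.exp (-(K * (1 - 2 * p) ^ 2 / 2)) := by
        rw [← Real.exp_half, ← Real.exp_nat_mul]
        ring_nf
    _ ≤ Real.exp (14 * (-1)) := by
        rw [div_le_iff₀ hη] at hK
        gcongr
        linarith
    _ = Real.exp (-1) ^ 14 := Real.exp_nat_mul (-1) 14
    _ ≤ (1 / 2) ^ 14 := by
        gcongr
        rw [Real.exp_neg, ← one_div]
        gcongr
        linarith [Real.exp_one_gt_d9]
    _ = (1 / 4) ^ 7 := by norm_num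

lemma exists_forall_lt_four_pow_achieves (h0 : 0 < p) (h1 : p < 1 / 2)
    (hK : 28 / (1 - 2 * p) ^ 2 ≤ K) (k : ℕ) :
    ∃ D, D + 9 * (3 ^ k * K) = 9 * (4 ^ k * K) ∧
      ∀ r < 4 ^ k, Achieves p r D (3 ^ k * K) ((1 / 4) ^ (k + 7)) := by
  induction k with
  | zero =>
    refine ⟨0, by simp, fun r hr => ?_⟩
    obtain rfl : r = 0 := by simpa using hr
    simpa using achieves_one_hop h0 h1 hK
  | succ k ih =>
    obtain ⟨D, hD, h⟩ := ih
    refine ⟨4 * D + 9 * (3 ^ k * K), by linear_combination 4 * hD, fun r hr => ?_⟩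
    rw [pow_succ'] at hr
    have hamplify := achieves_of_lt_four_mul h0.le (by linarith) (by positivity)
      (pow_le_pow_of_le_one (by norm_num) (by norm_num) (by omega)) h hr
    rwa [← mul_assoc 3, ← pow_succ', div_eq_mul_one_div, ← pow_succ, add_right_comm k] at hamplify

lemma exists_nat_div_le_mul_le {a η : ℝ} (ha : 0 ≤ a) (hη : 0 < η) (hη1 : η ≤ 1) :
    ∃ K : ℕ, a / η ≤ K ∧ K * η ≤ a + 1 := by
  refine ⟨⌈a / η⌉₊, Nat.le_ceil _, ?_⟩
  calc ⌈a / η⌉₊ * η ≤ (a / η + 1) * η := by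
        gcongr
        exact (Nat.ceil_lt_add_one (by positivity)).le
    _ = a + η := by field_simp
    _ ≤ a + 1 := by linarith

lemma exists_protocol_errorProb_le (h0 : 0 < p) (h1 : p < 1 / 2) (r : ℕ) :
    ∃ n : ℕ, (n : ℝ) * (1 - 2 * p) ^ 2 ≤ 1044 * ((r + 1 : ℕ) : ℝ) ∧
      ∃ P : Protocol r n, P.errorProb p ≤ 1 / ((r : ℝ) + 1) := by
  obtain ⟨K, hK, hK29⟩ := exists_nat_div_le_mul_le (a := 28) (η := (1 - 2 * p) ^ 2) (by norm_num)
    (sq_pos_of_pos (by linarith)) (by nlinarith)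
  set k := Nat.log 4 (r + 1) + 1 with hk
  have hlt : r + 1 < 4 ^ k := Nat.lt_pow_succ_log_self (by norm_num) _
  have hle : 4 ^ k ≤ 4 * (r + 1) := by
    rw [hk, pow_succ']
    exact Nat.mul_le_mul_left 4 (Nat.pow_log_le_self 4 r.succ_ne_zero)
  obtain ⟨D, hD, h⟩ := exists_forall_lt_four_pow_achieves h0 h1 hK k
  obtain ⟨P, hP⟩ := (h r (by omega)).exists_protocol h0.le (by linarith)
  refine ⟨D + 3 ^ k * K, ?_, P, hP.trans ?_⟩
  · calc ((D + 3 ^ k * K : ℕ) : ℝ) * (1 - 2 * p) ^ 2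
        ≤ ((9 * (4 * (r + 1) * K) : ℕ) : ℝ) * (1 - 2 * p) ^ 2 := by
          gcongr
          calc D + 3 ^ k * K ≤ 9 * (4 ^ k * K) := by omega
            _ ≤ 9 * (4 * (r + 1) * K) := by gcongr
      _ = 36 * ((r + 1 : ℕ) : ℝ) * (K * (1 - 2 * p) ^ 2) := by
          push_cast
          ring
      _ ≤ 36 * ((r + 1 : ℕ) : ℝ) * (28 + 1) := by gcongr
      _ = 1044 * ((r + 1 : ℕ) : ℝ) := by ring
  · calc (1 / 4 : ℝ) ^ (k + 7) ≤ (1 / 4) ^ k :=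
          pow_le_pow_of_le_one (by norm_num) (by norm_num) (by omega)
      _ = 1 / 4 ^ k := one_div_pow 4 k
      _ ≤ 1 / ((r : ℝ) + 1) := by
          gcongr
          exact_mod_cast hlt.le

lemma errorProb_nonneg (h0 : 0 ≤ p) (h1 : p ≤ 1) {n : ℕ} (P : Protocol r n) :
    0 ≤ P.errorProb p := by
  rw [P.errorProb_eq_sum_confusion]
  exact Finset.sum_nonneg fun θ _ =>
    mul_nonneg (by norm_num) ((isStochastic_confusion h0 h1 _ _ _).nonneg _ _)

lemma exists_hasVanishingError (h0 : 0 < p) (h1 : p < 1 / 2) :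
    ∃ n : ℕ → ℕ, HasVanishingError p n ∧
      ∀ r, (n r : ℝ) * (1 - 2 * p) ^ 2 ≤ 1044 * ((r + 1 : ℕ) : ℝ) := by
  choose n hn P hP using exists_protocol_errorProb_le h0 h1
  exact ⟨n, ⟨P, squeeze_zero (fun r => errorProb_nonneg h0.le (by linarith) (P r)) hP
    tendsto_one_div_add_atTop_nhds_zero_nat⟩, hn⟩

end HighNoise

section Velocity

variable {p ε : ℝ} {n : ℕ → ℕ}

lemma eventually_velocity_le (h0 : 0 ≤ p) (h1 : p ≤ 1) (hε : ε < 1 / 2)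
    (hP : ∀ᶠ r in atTop, ∃ P : Protocol r (n r), P.errorProb p ≤ ε) :
    ∀ᶠ r in atTop, 0 < n r ∧ ((r + 1 : ℕ) : ℝ) / (n r : ℝ) ≤ 2 * (1 - 2 * p) ^ 2 := by
  filter_upwards [hP, eventually_forall_hops_le h0 h1 hε] with r ⟨P, hP⟩ hr
  have hle := hr (n r) P hP
  refine ⟨Nat.pos_of_ne_zero fun hzero => ?_, div_le_of_le_mul₀ (by positivity) (by positivity) hle⟩
  rw [hzero, Nat.cast_zero, mul_zero] at hle
  exact (Nat.cast_pos.2 r.succ_pos).not_ge hle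

lemma liminf_limsup_mem_Icc {u : ℕ → ℝ} {a b : ℝ} (ha : ∀ᶠ r in atTop, a ≤ u r)
    (hb : ∀ᶠ r in atTop, u r ≤ b) :
    liminf u atTop ∈ Set.Icc a b ∧ limsup u atTop ∈ Set.Icc a b := by
  have habove : IsBoundedUnder (· ≤ ·) atTop u := isBoundedUnder_of_eventually_le hb
  have hbelow : IsBoundedUnder (· ≥ ·) atTop u := isBoundedUnder_of_eventually_ge ha
  have hle : liminf u atTop ≤ limsup u atTop := liminf_le_limsup habove hbelow
  have hlow : a ≤ liminf u atTop := le_liminf_of_le habove.isCoboundedUnder_ge ha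
  have hup : limsup u atTop ≤ b := limsup_le_of_le hbelow.isCoboundedUnder_le hb
  exact ⟨⟨hlow, hle.trans hup⟩, ⟨hlow.trans hle, hup⟩⟩

lemma velocity_mem_Icc (h0 : 0 ≤ p) (h1 : p ≤ 1) (hε : ε < 1 / 2)
    (hP : ∀ᶠ r in atTop, ∃ P : Protocol r (n r), P.errorProb p ≤ ε) {a : ℝ} (ha : 0 < a)
    (hn : ∀ᶠ r in atTop, (n r : ℝ) * (1 - 2 * p) ^ 2 ≤ a * ((r + 1 : ℕ) : ℝ)) :
    liminf (fun r : ℕ => ((r + 1 : ℕ) : ℝ) / (n r : ℝ)) atTop ∈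
        Set.Icc ((1 - 2 * p) ^ 2 / a) (2 * (1 - 2 * p) ^ 2) ∧
      limsup (fun r : ℕ => ((r + 1 : ℕ) : ℝ) / (n r : ℝ)) atTop ∈
        Set.Icc ((1 - 2 * p) ^ 2 / a) (2 * (1 - 2 * p) ^ 2) := by
  have hle := eventually_velocity_le h0 h1 hε hP
  refine liminf_limsup_mem_Icc ?_ (hle.mono fun r hr => hr.2)
  filter_upwards [hle, hn] with r ⟨hpos, _⟩ hr
  rw [div_le_div_iff₀ ha (Nat.cast_pos.2 hpos)]
  linarith

lemma HasVanishingError.eventually_exists_protocol (hn : HasVanishingError p n) (hε : 0 < ε) :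
    ∀ᶠ r in atTop, ∃ P : Protocol r (n r), P.errorProb p ≤ ε := by
  obtain ⟨P, hP⟩ := hn
  exact (hP.eventually_le_const hε).mono fun r hr => ⟨P r, hr⟩

lemma lowerVelocity_upperVelocity_mem_Icc (h0 : 0 < p) (h1 : p < 1 / 2) (hε0 : 0 < ε)
    (hε : ε < 1 / 2) :
    lowerVelocity ε p ∈ Set.Icc ((1 - 2 * p) ^ 2 / 1044) (2 * (1 - 2 * p) ^ 2) ∧
      upperVelocity ε p ∈ Set.Icc ((1 - 2 * p) ^ 2 / 1044) (2 * (1 - 2 * p) ^ 2) := by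
  obtain ⟨n, hn, hle⟩ := exists_hasVanishingError h0 h1
  have hex := hn.eventually_exists_protocol hε0
  refine velocity_mem_Icc (n := minBlockLength ε p) h0.le (by linarith) hε
    (hex.mono fun r hr => Nat.sInf_mem (s := {n | ∃ P : Protocol r n, P.errorProb p ≤ ε}) ⟨n r, hr⟩)
    (by norm_num) (hex.mono fun r hr => le_trans ?_ (hle r))
  gcongr
  exact Nat.sInf_le hr

lemma csSup_mem_Icc {S : Set ℝ} {a b v : ℝ} (hS : ∀ w ∈ S, w ≤ b) (hv : v ∈ S) (ha : a ≤ v) :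
    sSup S ∈ Set.Icc a b :=
  ⟨le_csSup_of_le ⟨b, hS⟩ hv ha, csSup_le ⟨v, hv⟩ hS⟩

lemma HasVanishingError.velocity_le (h0 : 0 ≤ p) (h1 : p ≤ 1) (hn : HasVanishingError p n) :
    liminf (fun r : ℕ => ((r + 1 : ℕ) : ℝ) / (n r : ℝ)) atTop ≤ 2 * (1 - 2 * p) ^ 2 ∧
      limsup (fun r : ℕ => ((r + 1 : ℕ) : ℝ) / (n r : ℝ)) atTop ≤ 2 * (1 - 2 * p) ^ 2 := by
  have hP := hn.eventually_exists_protocol (ε := 1 / 3) (by norm_num)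
  have hmem := liminf_limsup_mem_Icc (.of_forall fun r => by positivity)
    ((eventually_velocity_le h0 h1 (by norm_num) hP).mono fun r hr => hr.2)
  exact ⟨hmem.1.2, hmem.2.2⟩

lemma vanishingVelocity_mem_Icc (h0 : 0 < p) (h1 : p < 1 / 2) :
    lowerVanishingVelocity p ∈ Set.Icc ((1 - 2 * p) ^ 2 / 1044) (2 * (1 - 2 * p) ^ 2) ∧
      upperVanishingVelocity p ∈ Set.Icc ((1 - 2 * p) ^ 2 / 1044) (2 * (1 - 2 * p) ^ 2) := by
  have hp1 : p ≤ 1 := by linarith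
  obtain ⟨n, hn, hle⟩ := exists_hasVanishingError h0 h1
  obtain ⟨hlow, hup⟩ := velocity_mem_Icc h0.le hp1 (by norm_num)
    (hn.eventually_exists_protocol (ε := 1 / 3) (by norm_num)) (by norm_num) (.of_forall hle)
  refine ⟨csSup_mem_Icc ?_ ⟨n, hn, rfl⟩ hlow.1, csSup_mem_Icc ?_ ⟨n, hn, rfl⟩ hup.1⟩
  · rintro _ ⟨n', hn', rfl⟩
    exact (hn'.velocity_le h0.le hp1).1
  · rintro _ ⟨n', hn', rfl⟩
    exact (hn'.velocity_le h0.le hp1).2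

lemma isTheta_sq_of_mem_Icc {v : ℝ → ℝ} {a b : ℝ} (ha : 0 < a)
    (h : ∀ p, 0 < p → p < 1 / 2 → v p ∈ Set.Icc ((1 - 2 * p) ^ 2 / a) (b * (1 - 2 * p) ^ 2)) :
    (fun δ => v ((1 - δ) / 2)) =Θ[𝓝[>] 0] fun δ : ℝ => δ ^ 2 := by
  have hev : ∀ᶠ δ : ℝ in 𝓝[>] 0, v ((1 - δ) / 2) ∈ Set.Icc (δ ^ 2 / a) (b * δ ^ 2) := by
    filter_upwards [Ioo_mem_nhdsGT one_pos] with δ ⟨hδ0, hδ1⟩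
    have hmem := h ((1 - δ) / 2) (by linarith) (by linarith)
    rwa [show 1 - 2 * ((1 - δ) / 2) = δ by ring] at hmem
  have hnonneg : ∀ᶠ δ : ℝ in 𝓝[>] 0, 0 ≤ v ((1 - δ) / 2) :=
    hev.mono fun δ hδ => le_trans (by positivity) hδ.1
  constructor
  · refine IsBigO.of_bound b ?_
    filter_upwards [hev, hnonneg] with δ hδ hv
    rw [Real.norm_of_nonneg hv, Real.norm_of_nonneg (sq_nonneg δ)]
    exact hδ.2
  · refine IsBigO.of_bound a ?_
    filter_upwards [hev, hnonneg] with δ hδ hv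
    rw [Real.norm_of_nonneg hv, Real.norm_of_nonneg (sq_nonneg δ)]
    exact (div_le_iff₀' ha).1 hδ.1

end Velocity

end BitRelay
theorem theorem3_general {p : ℝ} (h0 : 0 < p) (h1 : p < 1 / 2) :
    (∀ ε : ℝ, 0 < ε → ε < 1 / 2 →
      BitRelay.lowerVelocity ε p ∈ Set.Icc ((1 - 2 * p) ^ 2 / 1044) (2 * (1 - 2 * p) ^ 2) ∧
      BitRelay.upperVelocity ε p ∈ Set.Icc ((1 - 2 * p) ^ 2 / 1044) (2 * (1 - 2 * p) ^ 2)) ∧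
    BitRelay.lowerVanishingVelocity p ∈
      Set.Icc ((1 - 2 * p) ^ 2 / 1044) (2 * (1 - 2 * p) ^ 2) ∧
    BitRelay.upperVanishingVelocity p ∈
      Set.Icc ((1 - 2 * p) ^ 2 / 1044) (2 * (1 - 2 * p) ^ 2) :=
  ⟨fun _ => BitRelay.lowerVelocity_upperVelocity_mem_Icc h0 h1,
    BitRelay.vanishingVelocity_mem_Icc h0 h1⟩

theorem theorem3 :
    (∀ ε : ℝ, 0 < ε → ε < 1 / 2 →
      ((fun δ : ℝ => BitRelay.lowerVelocity ε ((1 - δ) / 2)) =Θ[𝓝[>] 0] fun δ : ℝ => δ ^ 2) ∧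
      ((fun δ : ℝ => BitRelay.upperVelocity ε ((1 - δ) / 2)) =Θ[𝓝[>] 0] fun δ : ℝ => δ ^ 2)) ∧
    ((fun δ : ℝ => BitRelay.lowerVanishingVelocity ((1 - δ) / 2))
      =Θ[𝓝[>] 0] fun δ : ℝ => δ ^ 2) ∧
    ((fun δ : ℝ => BitRelay.upperVanishingVelocity ((1 - δ) / 2))
      =Θ[𝓝[>] 0] fun δ : ℝ => δ ^ 2) := by
  refine ⟨fun ε hε0 hε => ⟨?_, ?_⟩, ?_, ?_⟩ <;>
    refine BitRelay.isTheta_sq_of_mem_Icc (a := 1044) (b := 2) (by norm_num) fun p h0 h1 => ?_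
  exacts [((theorem3_general h0 h1).1 ε hε0 hε).1, ((theorem3_general h0 h1).1 ε hε0 hε).2,
    (theorem3_general h0 h1).2.1, (theorem3_general h0 h1).2.2]
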